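/- Let $\Gamma$ be a finite abelian group, $G$ a connected (finite-dimensional, real) Lie group with Lie algebra $\mathfrak g$, and $H\subset G$ a subgroup such that $M=G/H$ is a $\Gamma$-symmetric space, that is: the Lie algebra of $H$ contains no nonzero proper ideal of $\mathfrak g$, and there is an injective homomorphism $\rho:\Gamma\to\mathrm{Aut}(G)$, $\gamma\mapsto\rho_\gamma$, into the group of Lie group automorphisms of $G$ with $$(G^\Gamma)_e\subset H\subset G^\Gamma,$$ where $G^\Gamma=\{g\in G:\rho_\gamma(g)=g\ \ \forall\gamma\in\Gamma\}$ and $(G^\Gamma)_e$ is its identity component. Give $M=G/H$ its standard smooth structure, for which $G\to G/H$, $g\mapsto\bar g$, is a smooth submersion. For $\gamma\in\Gamma$ and $x=\overline{g_0}\in M$ let $s_{(\gamma,x)}:M\to M$ be the (well-defined) map $$s_{(\gamma,x)}(\bar g)=\overline{g_0\,\rho_\gamma(g_0^{-1}g)} .$$ **Proposition.** 1. For every $x\in M$, the set $\Gamma_x=\{s_{(\gamma,x)}:\gamma\in\Gamma\}$ is a subgroup of the group $\mathrm{Diff}(M)$ of smooth diffeomorphisms of $M$, the map $\gamma\mapsto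 s_{(\gamma,x)}$ is an isomorphism $\Gamma\to\Gamma_x$, and $x$ is an isolated fixed point of $\Gamma_x$: it is fixed by every element of $\Gamma_x$, and it has a neighbourhood that contains no other point fixed by all of $\Gamma_x$. 2. The tangent maps $S_x(\gamma)=(Ts_{(\gamma,x)})_x$ form a $\Gamma$-symmetric structure on $M$, that is: - for every $x\in M$, $S_x:\Gamma\to \mathrm{GL}(T_xM)$ is a linear representation of $\Gamma$; - for every $\gamma\in\Gamma$, $x\mapsto S_x(\gamma)$ is a $C^\infty$ section of the bundle $\mathrm{End}(TM)$ (a smooth $(1,1)$-tensor field); - for every $x\in M$, $\{v\in T_xM: S_x(\gamma)v=v\ \ \forall\gamma\in\Gamma\}=\{0\}$. -/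

import Mathlib

open scoped Manifold ContDiff Topology

noncomputable section

/-- The subgroup `G^Γ` of the elements of `G` that are fixed by all automorphisms `ρ γ`. -/
def fixedSubgroup {Γ G : Type*} [Group Γ] [Group G] (ρ : Γ →* MulAut G) : Subgroup G where
  carrier := {g | ∀ γ, ρ γ g = g}
  one_mem' := fun γ => map_one (ρ γ)
  mul_mem' := fun {a b} ha hb γ => by rw [map_mul, ha γ, hb γ]
  inv_mem' := fun {a} ha γ => by rw [map_inv, ha γ]

/-- The Lie algebra of a closed subgroup `H` of a Lie group `G`, as a subset of the Lie algebra
`T_e G` of `G`: the velocities at `0` of the smooth one-parameter subgroups of `G` that lie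
in `H`. -/
def lieAlgebraOfSubgroup {E G : Type*} [NormedAddCommGroup E] [NormedSpace ℝ E]
    [TopologicalSpace G] [ChartedSpace E G] [Group G] (H : Subgroup G) :
    Set (GroupLieAlgebra 𝓘(ℝ, E) G) :=
  {X | ∃ c : ℝ → G, ContMDiff 𝓘(ℝ, ℝ) 𝓘(ℝ, E) ∞ c ∧ (∀ s t, c (s + t) = c s * c t) ∧
    (∀ t, c t ∈ H) ∧
    tangentMap 𝓘(ℝ, ℝ) 𝓘(ℝ, E) c ⟨0, (1 : ℝ)⟩ = (⟨1, X⟩ : TangentBundle 𝓘(ℝ, E) G)}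

/-- The data and conditions making `G / H` a `Γ`-symmetric space, for a Lie group `G`, a subgroup
`H` of `G` and a finite abelian group `Γ`. -/
structure GammaSymmetricSpace (Γ E : Type*) {G : Type*} [CommGroup Γ] [Finite Γ]
    [NormedAddCommGroup E] [NormedSpace ℝ E]
    [TopologicalSpace G] [ChartedSpace E G] [Group G] [LieGroup 𝓘(ℝ, E) ∞ G]
    (H : Subgroup G) where
  /-- `G` is connected. -/
  connected : ConnectedSpace G
  /-- `G` is effective on `G / H`: the Lie algebra of `H` contains no nonzero proper ideal of the
  Lie algebra of `G`. -/
  effective : ∀ 𝔞 : Submodule ℝ (GroupLieAlgebra 𝓘(ℝ, E) G),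
    (∀ X : GroupLieAlgebra 𝓘(ℝ, E) G, ∀ Y ∈ 𝔞, ⁅X, Y⁆ ∈ 𝔞) →
    (𝔞 : Set (GroupLieAlgebra 𝓘(ℝ, E) G)) ⊆ lieAlgebraOfSubgroup H → 𝔞 = ⊥ ∨ 𝔞 = ⊤
  /-- The action of `Γ` on `G` by group automorphisms. -/
  rho : Γ →* MulAut G
  /-- The automorphisms are smooth, that is, they are automorphisms of the Lie group `G`. -/
  contMDiff_rho : ∀ γ, ContMDiff 𝓘(ℝ, E) 𝓘(ℝ, E) ∞ (rho γ)
  rho_injective : Function.Injective rho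
  /-- The identity component of `G^Γ` is contained in `H`. -/
  component_subset : connectedComponentIn (fixedSubgroup rho : Set G) 1 ⊆ (H : Set G)
  /-- `H` is contained in `G^Γ`. -/
  le_fixed : H ≤ fixedSubgroup rho

namespace GammaSymmetricSpace

variable {Γ E G : Type*} [CommGroup Γ] [Finite Γ] [NormedAddCommGroup E] [NormedSpace ℝ E]
  [TopologicalSpace G] [ChartedSpace E G] [Group G] [LieGroup 𝓘(ℝ, E) ∞ G] {H : Subgroup G}
  (D : GammaSymmetricSpace Γ E H)

/-- The map `s_(γ, ē)` of `G / H` that sends the class of `g` to the class of `ρ_γ g`. -/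
def baseSymmetry (γ : Γ) : G ⧸ H → G ⧸ H :=
  Quotient.map' (fun g => D.rho γ g) fun a b hab => by
    rw [QuotientGroup.leftRel_apply] at hab ⊢
    rw [← map_inv, ← map_mul, D.le_fixed hab γ]
    exact hab

/-- The map `s_(γ, x)` of `G / H`: for `x` the class of `g₀`, it sends `y` to
`g₀ • s_(γ, ē) (g₀⁻¹ • y)`. -/
def symmetryFun (γ : Γ) (x : G ⧸ H) : G ⧸ H → G ⧸ H :=
  Quotient.liftOn' x (fun g₀ y => g₀ • D.baseSymmetry γ (g₀⁻¹ • y)) fun a b hab => by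
    rw [QuotientGroup.leftRel_apply] at hab
    funext y
    induction y using QuotientGroup.induction_on with
    | H g =>
      have h := D.le_fixed hab γ
      rw [map_mul, map_inv, inv_mul_eq_iff_eq_mul] at h
      change ((a * D.rho γ (a⁻¹ * g) : G) : G ⧸ H) = ((b * D.rho γ (b⁻¹ * g) : G) : G ⧸ H)
      congr 1
      simp only [map_mul, map_inv, h]
      group

theorem symmetryFun_mk (γ : Γ) (a g : G) :
    D.symmetryFun γ (a : G ⧸ H) (g : G ⧸ H) = ((a * D.rho γ (a⁻¹ * g) : G) : G ⧸ H) :=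
  rfl

theorem symmetryFun_one (x y : G ⧸ H) : D.symmetryFun 1 x y = y := by
  induction x using QuotientGroup.induction_on with
  | H a =>
    induction y using QuotientGroup.induction_on with
    | H g => simp [symmetryFun_mk]

theorem symmetryFun_mul (γ δ : Γ) (x y : G ⧸ H) :
    D.symmetryFun (γ * δ) x y = D.symmetryFun γ x (D.symmetryFun δ x y) := by
  induction x using QuotientGroup.induction_on with
  | H a =>
    induction y using QuotientGroup.induction_on with
    | H g => simp [symmetryFun_mk]

/-- The homomorphism `γ ↦ s_(γ, x)` from `Γ` to the permutations of `G / H`. -/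
def symmetry (x : G ⧸ H) : Γ →* Equiv.Perm (G ⧸ H) where
  toFun γ :=
    { toFun := D.symmetryFun γ x
      invFun := D.symmetryFun γ⁻¹ x
      left_inv := fun y => by rw [← symmetryFun_mul, inv_mul_cancel, symmetryFun_one]
      right_inv := fun y => by rw [← symmetryFun_mul, mul_inv_cancel, symmetryFun_one] }
  map_one' := Equiv.ext (D.symmetryFun_one x)
  map_mul' γ δ := Equiv.ext (D.symmetryFun_mul γ δ x)

theorem symmetry_mk (γ : Γ) (a g : G) :
    D.symmetry (a : G ⧸ H) γ (g : G ⧸ H) = ((a * D.rho γ (a⁻¹ * g) : G) : G ⧸ H) :=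
  rfl

/-- The group `Γ_x` of symmetries of `G / H` at `x`. -/
def symmetryGroup (x : G ⧸ H) : Subgroup (Equiv.Perm (G ⧸ H)) :=
  (D.symmetry x).range

end GammaSymmetricSpace

/-- The group `Diff(M)` of smooth diffeomorphisms of `M`, as a subgroup of the permutations. -/
def diffeoGroup (F M : Type*) [NormedAddCommGroup F] [NormedSpace ℝ F]
    [TopologicalSpace M] [ChartedSpace F M] : Subgroup (Equiv.Perm M) where
  carrier := {f | ContMDiff 𝓘(ℝ, F) 𝓘(ℝ, F) ∞ f ∧ ContMDiff 𝓘(ℝ, F) 𝓘(ℝ, F) ∞ f.symm}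
  one_mem' := ⟨contMDiff_id, contMDiff_id⟩
  mul_mem' := fun ha hb => ⟨ha.1.comp hb.1, hb.2.comp ha.2⟩
  inv_mem' := fun ha => ⟨ha.2, ha.1⟩

/-- `x` is an isolated fixed point of the group `K` of permutations of `M`. -/
def IsIsolatedFixedPoint {M : Type*} [TopologicalSpace M] (K : Subgroup (Equiv.Perm M))
    (x : M) : Prop :=
  (∀ f ∈ K, f x = x) ∧ ∃ U ∈ 𝓝 x, ∀ y ∈ U, (∀ f ∈ K, f y = y) → y = x

/-- A `Γ`-symmetric structure on a smooth manifold `M` modelled on the finite-dimensional real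
vector space `F`. Every linear automorphism of `T_x M` is continuous, so `GL(T_x M)` is the group
of continuous linear automorphisms. -/
structure GammaSymmetricStructure (Γ F M : Type*) [CommGroup Γ] [Finite Γ]
    [NormedAddCommGroup F] [NormedSpace ℝ F] [FiniteDimensional ℝ F]
    [TopologicalSpace M] [ChartedSpace F M] [IsManifold 𝓘(ℝ, F) ∞ M] where
  /-- The representation of `Γ` on each tangent space. -/
  rep : ∀ x : M, Γ →* (TangentSpace 𝓘(ℝ, F) x ≃L[ℝ] TangentSpace 𝓘(ℝ, F) x)
  /-- For each `γ`, the field `x ↦ rep x γ` of endomorphisms is a smooth section of the bundle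
  `End(TM)`. -/
  contMDiff_rep : ∀ γ : Γ, ContMDiff 𝓘(ℝ, F) (𝓘(ℝ, F).prod 𝓘(ℝ, F →L[ℝ] F)) ∞
    (fun x : M => Bundle.TotalSpace.mk' (F →L[ℝ] F)
      (E := fun y : M => TangentSpace 𝓘(ℝ, F) y →L[ℝ] TangentSpace 𝓘(ℝ, F) y) x
      (rep x γ : TangentSpace 𝓘(ℝ, F) x →L[ℝ] TangentSpace 𝓘(ℝ, F) x))
  /-- No nonzero tangent vector is fixed by all of `Γ`. -/
  eq_zero_of_fixed : ∀ (x : M) (v : TangentSpace 𝓘(ℝ, F) x), (∀ γ, rep x γ v = v) → v = 0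

end

/-!
Write `π : G → M = G ⧸ H` for the projection and `θ_γ` for the derivative of `ρ_γ` at `1`.

*Smoothness.* A submersion has smooth local sections
(`Manifold.IsSubmersionAt.exists_localSection`). Lifting both arguments to `G` shows that
`(x, y) ↦ s_(γ, x)(y)` is smooth on `M × M` (`contMDiff_uncurry_symmetryFun`). Hence each
`s_(γ, x)` is a diffeomorphism with inverse `s_(γ⁻¹, x)`, and its partial derivative in `y` along
the diagonal, which is `S_x(γ)`, depends smoothly on `x`.

*Linearization.* Near a fixed point, a finite group of `C^1` maps becomes linear in the chart
obtained by averaging `θ_γ⁻¹ ∘ κ ∘ ρ_γ` over the group, for any chart `κ`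
(`exists_linearization`). It follows that every fixed tangent vector is the velocity of a curve in
the component of the fixed point set, that the fixed point is isolated if no nonzero tangent
vector is fixed, and that an element with identity derivative acts trivially nearby.

*No fixed vectors.* For `x` the class of `g₀`, the map `p : g ↦ g₀ g H` is a submersion and
intertwines `ρ_γ` with `s_(γ, x)`. If `v = dp(X)` is fixed by all `S_x(γ)`, then `dp` sends the
sum `Y` of the vectors `θ_γ X` to `|Γ| v`. Now `Y` is fixed by `Γ`, so it is the velocity of a
curve in `(G^Γ)_e ⊆ H`, on which `p` is constant, and therefore `v = 0`. Linearizing the action of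
`Γ` on `M` at `x`, one concludes that `x` is an isolated fixed point.

*Injectivity.* If `s_(γ, x)` is the identity, then `ρ_γ(g) = g h(g)` with `h(g) ∈ H ⊆ G^Γ`. With
`A` the derivative of `h` at `1` this gives `θ_γ = 1 + A` and `θ_γ A = A`, hence
`θ_γ ^ k = 1 + k A` for `k ≥ 1`; as `γ` has finite order, `A = 0`. So `θ_γ = 1`, and `ρ_γ` is the
identity near `1` by linearization, hence on the connected group `G`
(`eq_one_of_inv_mul_rho_mem`).
-/

/-! ### Local sections of submersions -/

/-- A submersion has a local section through every point: in charts in which the map is the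
projection `(u, w) ↦ u`, keep the coordinate `w` constant. -/
theorem Manifold.IsSubmersionAt.exists_localSection {E F M N : Type*}
    [NormedAddCommGroup E] [NormedSpace ℝ E] [NormedAddCommGroup F] [NormedSpace ℝ F]
    [TopologicalSpace M] [ChartedSpace E M] [TopologicalSpace N] [ChartedSpace F N]
    {n : WithTop ℕ∞} [IsManifold 𝓘(ℝ, E) n M] [IsManifold 𝓘(ℝ, F) n N] {f : M → N} {x : M}
    (hf : Manifold.IsSubmersionAt 𝓘(ℝ, E) 𝓘(ℝ, F) n f x) :
    ∃ σ : N → M, ContMDiffAt 𝓘(ℝ, F) 𝓘(ℝ, E) n σ (f x) ∧ σ (f x) = x ∧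
      ∀ᶠ y in 𝓝 (f x), f (σ y) = y := by
  have hφ := hf.domChart_mem_maximalAtlas
  have hψ := hf.codChart_mem_maximalAtlas
  have hxφ := hf.mem_domChart_source
  have hxψ := hf.mem_codChart_source
  have hw := hf.writtenInCharts
  have hsub := hf.source_subset_preimage_source
  set φ := hf.domChart
  set ψ := hf.codChart
  simp only [OpenPartialHomeomorph.extend_coe, OpenPartialHomeomorph.extend_coe_symm,
    modelWithCornersSelf_coe, modelWithCornersSelf_coe_symm, Function.comp_id, Function.id_comp,
    OpenPartialHomeomorph.extend_target, Set.range_id, Set.inter_univ, Set.preimage_id] at hw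
  let e := hf.equiv
  let l : N → E := fun y => e.symm (ψ y, (e (φ x)).2)
  have hl : ContMDiffAt 𝓘(ℝ, F) 𝓘(ℝ, E) n l (f x) :=
    e.symm.contDiff.contMDiff.contMDiffAt.comp _
      ((contMDiffAt_of_mem_maximalAtlas hψ hxψ).prodMk_space contMDiffAt_const)
  have hx0 : φ x ∈ φ.target := φ.map_source hxφ
  have hψx : ψ (f x) = (e (φ x)).1 := by
    have := hw hx0
    simpa [hxφ] using this
  have hlx : l (f x) = φ x := by simp [l, hψx]
  refine ⟨fun y => φ.symm (l y), ?_, by simp [hlx, hxφ], ?_⟩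
  · have := contMDiffAt_symm_of_mem_maximalAtlas hφ hx0
    rw [← hlx] at this
    exact this.comp _ hl
  · have h1 : ∀ᶠ y in 𝓝 (f x), l y ∈ φ.target :=
      hl.continuousAt.eventually_mem (by rw [hlx]; exact φ.open_target.mem_nhds hx0)
    filter_upwards [h1, ψ.open_source.mem_nhds hxψ] with y hy hyψ
    have h2 := hw hy
    simp only [Function.comp_apply] at h2
    apply ψ.injOn (hsub (φ.map_target hy)) hyψ
    rw [h2]
    exact congrArg Prod.fst (e.apply_symm_apply _)

/-! ### Linearization of finite group actions at fixed points -/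

/-- **Linearization of a finite group action at a fixed point**, in a normed space. The
group laws are only required near the fixed point, since the maps may be group elements read in a
chart. The linearizing map is the average of `u ↦ A γ⁻¹ (a γ u - u₀)`, where `A γ` is the
derivative of `a γ` at `u₀`. -/
theorem exists_linearization_of_contDiffAt {Γ E : Type*} [Group Γ] [Finite Γ]
    [NormedAddCommGroup E] [NormedSpace ℝ E] [CompleteSpace E] {a : Γ → E → E} {u₀ : E}
    (ha : ∀ γ, ContDiffAt ℝ 1 (a γ) u₀) (hfix : ∀ γ, a γ u₀ = u₀)
    (hone : a 1 =ᶠ[𝓝 u₀] id) (hmul : ∀ γ δ, a (γ * δ) =ᶠ[𝓝 u₀] a γ ∘ a δ) :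
    ∃ Φ : OpenPartialHomeomorph E E, u₀ ∈ Φ.source ∧ Φ u₀ = 0 ∧
      HasFDerivAt Φ.symm (ContinuousLinearMap.id ℝ E) 0 ∧
      ∀ γ, ∀ᶠ u in 𝓝 u₀, Φ (a γ u) = fderiv ℝ (a γ) u₀ (Φ u) := by
  classical
  have := Fintype.ofFinite Γ
  let A : Γ → E →L[ℝ] E := fun γ => fderiv ℝ (a γ) u₀
  have hA : ∀ γ, HasStrictFDerivAt (a γ) (A γ) u₀ := fun γ =>
    (ha γ).hasStrictFDerivAt one_ne_zero
  have hA1 : A 1 = ContinuousLinearMap.id ℝ E := by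
    simp only [A]
    rw [hone.fderiv_eq]
    exact fderiv_id
  have hAmul : ∀ γ δ, A (γ * δ) = A γ ∘L A δ := fun γ δ => by
    simp only [A]
    rw [(hmul γ δ).fderiv_eq, fderiv_comp, hfix]
    · rw [hfix]; exact (hA γ).differentiableAt
    · exact (hA δ).differentiableAt
  have hAinv : ∀ γ v, A γ⁻¹ (A γ v) = v := fun γ v => by
    have := hAmul γ⁻¹ γ
    rw [inv_mul_cancel, hA1] at this
    exact (congrArg (· v) this).symm
  let c : ℝ := (Fintype.card Γ : ℝ)
  have hc : c ≠ 0 := by simp [c]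
  let f : E → E := fun u => c⁻¹ • ∑ γ, A γ⁻¹ (a γ u - u₀)
  have hf : HasStrictFDerivAt f ((ContinuousLinearEquiv.refl ℝ E : E ≃L[ℝ] E) : E →L[ℝ] E) u₀ := by
    have h1 : HasStrictFDerivAt f (c⁻¹ • ∑ γ, A γ⁻¹ ∘L A γ) u₀ :=
      (HasStrictFDerivAt.fun_sum fun γ _ =>
        (A γ⁻¹).hasStrictFDerivAt.comp u₀ ((hA γ).sub_const u₀)).const_smul c⁻¹
    convert h1 using 1
    ext v
    simp [hAinv, ← Nat.cast_smul_eq_nsmul ℝ, smul_smul, c]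
  have hf0 : f u₀ = 0 := by simp [f, hfix]
  refine ⟨hf.toOpenPartialHomeomorph f, hf.mem_toOpenPartialHomeomorph_source, hf0, ?_, ?_⟩
  · have := hf.to_localInverse.hasFDerivAt
    rw [hf0] at this
    exact this
  · intro γ
    have hev : ∀ᶠ u in 𝓝 u₀, ∀ δ, a (δ * γ) u = a δ (a γ u) :=
      Filter.eventually_all.2 fun δ => hmul δ γ
    filter_upwards [hev] with u hu
    change f (a γ u) = A γ (f u)
    simp only [f, map_smul, map_sum]
    congr 1
    -- Equivariance of the average: reindex the sum by `δ ↦ δ * γ`.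
    rw [← Equiv.sum_comp (Equiv.mulRight γ) (fun δ => A γ (A δ⁻¹ (a δ u - u₀)))]
    refine Finset.sum_congr rfl fun δ _ => ?_
    simp only [Equiv.coe_mulRight, hu]
    rw [← ContinuousLinearMap.comp_apply, ← hAmul, mul_inv_rev, mul_inv_cancel_left]

/-- **Linearization of a finite group action at a fixed point**, on a manifold: around a fixed
point `x` there is a chart centred at `x` in which each element of the group acts as its derivative
at `x`. The derivative of its inverse is the identity of the model space `E`, of which `T_x M` is a
copy. -/
theorem exists_linearization {Γ E M : Type*} [Group Γ] [Finite Γ]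
    [NormedAddCommGroup E] [NormedSpace ℝ E] [CompleteSpace E]
    [TopologicalSpace M] [ChartedSpace E M] [IsManifold 𝓘(ℝ, E) 1 M]
    (ρ : Γ →* Equiv.Perm M) {x : M}
    (hρ : ∀ γ, ContMDiffAt 𝓘(ℝ, E) 𝓘(ℝ, E) 1 (ρ γ) x) (hfix : ∀ γ, ρ γ x = x)
    {L : Γ → E →L[ℝ] E} (hL : ∀ γ, HasMFDerivAt 𝓘(ℝ, E) 𝓘(ℝ, E) (ρ γ) x (L γ)) :
    ∃ Φ : OpenPartialHomeomorph M E, x ∈ Φ.source ∧ Φ x = 0 ∧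
      HasMFDerivAt 𝓘(ℝ, E) 𝓘(ℝ, E) Φ.symm 0 (ContinuousLinearMap.id ℝ E) ∧
      ∀ γ, ∀ᶠ y in 𝓝 x, Φ (ρ γ y) = L γ (Φ y) := by
  let κ := chartAt E x
  have hxκ : x ∈ κ.source := mem_chart_source E x
  let a : Γ → E → E := fun γ u => κ (ρ γ (κ.symm u))
  have hκx : κ.symm (κ x) = x := κ.left_inv hxκ
  have hcont : ContinuousAt κ.symm (κ x) := κ.continuousAt_symm (κ.map_source hxκ)
  have hcontρ : ∀ γ, ContinuousAt (fun u => ρ γ (κ.symm u)) (κ x) := fun γ =>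
    ContinuousAt.comp (by rw [hκx]; exact (hρ γ).continuousAt) hcont
  have hfixa : ∀ γ, a γ (κ x) = κ x := fun γ => by simp only [a, hκx, hfix]
  have ha : ∀ γ, ContDiffAt ℝ 1 (a γ) (κ x) := fun γ => by
    have h := (contMDiffAt_iff.1 (hρ γ)).2
    simp only [hfix, mfld_simps, contDiffWithinAt_univ] at h
    exact h
  have hone : a 1 =ᶠ[𝓝 (κ x)] id := by
    filter_upwards [κ.open_target.mem_nhds (κ.map_source hxκ)] with u hu
    simp [a, hu]
  have hsrc : ∀ γ, ∀ᶠ u in 𝓝 (κ x), ρ γ (κ.symm u) ∈ κ.source := fun γ =>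
    (hcontρ γ).eventually_mem (by rw [hκx, hfix]; exact κ.open_source.mem_nhds hxκ)
  have hmul : ∀ γ δ, a (γ * δ) =ᶠ[𝓝 (κ x)] a γ ∘ a δ := fun γ δ => by
    filter_upwards [hsrc δ] with u hu
    simp [a, hu]
  have hder : ∀ γ, L γ = fderiv ℝ (a γ) (κ x) := fun γ => by
    have h : HasFDerivWithinAt (writtenInExtChartAt 𝓘(ℝ, E) 𝓘(ℝ, E) x (ρ γ)) (L γ)
        (Set.range 𝓘(ℝ, E)) (extChartAt 𝓘(ℝ, E) x x) := (hL γ).2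
    simp only [writtenInExtChartAt, hfix, mfld_simps, hasFDerivWithinAt_univ] at h
    exact h.fderiv.symm
  obtain ⟨Φ, hs, h0, hd, hΦ⟩ := exists_linearization_of_contDiffAt ha hfixa hone hmul
  refine ⟨κ.trans Φ, by simp [hxκ, hs], by simpa using h0, ?_, fun γ => ?_⟩
  · have hΦ0 : Φ.symm 0 = κ x := by rw [← h0, Φ.left_inv hs]
    have h1 : HasMFDerivAt 𝓘(ℝ, E) 𝓘(ℝ, E) κ.symm (κ x) (ContinuousLinearMap.id ℝ E) := by
      have h2 : MDifferentiableAt 𝓘(ℝ, E) 𝓘(ℝ, E) κ.symm (κ x) :=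
        (contMDiffAt_symm_of_mem_maximalAtlas (IsManifold.chart_mem_maximalAtlas (n := 1) x)
          (κ.map_source hxκ)).mdifferentiableAt one_ne_zero
      refine ⟨h2.continuousAt, ?_⟩
      simp only [writtenInExtChartAt, mfld_simps]
      refine HasFDerivAt.hasFDerivWithinAt ?_
      rw [hκx]
      refine (hasFDerivAt_id _).congr_of_eventuallyEq ?_
      filter_upwards [κ.open_target.mem_nhds (κ.map_source hxκ)] with u hu
      exact κ.right_inv hu
    rw [← hΦ0] at h1
    have := HasMFDerivAt.comp (0 : E) h1 hd.hasMFDerivAt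
    exact this
  · have hev : ∀ᶠ y in 𝓝 x, Φ (a γ (κ y)) = fderiv ℝ (a γ) (κ x) (Φ (κ y)) :=
      (κ.continuousAt hxκ).eventually (hΦ γ)
    filter_upwards [hev, κ.open_source.mem_nhds hxκ] with y hy hyκ
    rw [hder]
    simp only [a, κ.left_inv hyκ] at hy
    exact hy

section FiniteActions

variable {Γ E M : Type*} [Group Γ] [Finite Γ]
  [NormedAddCommGroup E] [NormedSpace ℝ E] [CompleteSpace E]
  [TopologicalSpace M] [ChartedSpace E M] [IsManifold 𝓘(ℝ, E) 1 M]

/-- A fixed point of a finite group is isolated if the group fixes no nonzero tangent vector. -/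
theorem eventually_eq_of_forall_fixed (ρ : Γ →* Equiv.Perm M) {x : M}
    (hρ : ∀ γ, ContMDiffAt 𝓘(ℝ, E) 𝓘(ℝ, E) 1 (ρ γ) x) (hfix : ∀ γ, ρ γ x = x)
    {L : Γ → E →L[ℝ] E} (hL : ∀ γ, HasMFDerivAt 𝓘(ℝ, E) 𝓘(ℝ, E) (ρ γ) x (L γ))
    (h0 : ∀ v : E, (∀ γ, L γ v = v) → v = 0) :
    ∀ᶠ y in 𝓝 x, (∀ γ, ρ γ y = y) → y = x := by
  obtain ⟨Φ, hs, hx0, -, hΦ⟩ := exists_linearization ρ hρ hfix hL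
  filter_upwards [Filter.eventually_all.2 hΦ, Φ.open_source.mem_nhds hs] with y hy hys hfy
  refine Φ.injOn hys hs ?_
  rw [hx0]
  exact h0 _ fun γ => by rw [← hy γ, hfy γ]

/-- An element of a finite group whose derivative at a common fixed point is the identity acts
trivially near that point. -/
theorem eventually_eq_self_of_hasMFDerivAt_id (ρ : Γ →* Equiv.Perm M) {x : M}
    (hρ : ∀ γ, ContMDiffAt 𝓘(ℝ, E) 𝓘(ℝ, E) 1 (ρ γ) x) (hfix : ∀ γ, ρ γ x = x)
    {L : Γ → E →L[ℝ] E} (hL : ∀ γ, HasMFDerivAt 𝓘(ℝ, E) 𝓘(ℝ, E) (ρ γ) x (L γ)) {γ : Γ}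
    (hγ : ∀ v : E, L γ v = v) :
    ∀ᶠ y in 𝓝 x, ρ γ y = y := by
  obtain ⟨Φ, hs, -, -, hΦ⟩ := exists_linearization ρ hρ hfix hL
  have hsrc : ∀ᶠ y in 𝓝 x, ρ γ y ∈ Φ.source :=
    (hρ γ).continuousAt.eventually_mem (by rw [hfix]; exact Φ.open_source.mem_nhds hs)
  filter_upwards [hΦ γ, Φ.open_source.mem_nhds hs, hsrc] with y hy hys hys'
  exact Φ.injOn hys' hys (hy.trans (hγ _))

/-- A tangent vector fixed by a finite group is the velocity of a curve in the
connected component of the set of fixed points: take a line in a linearizing chart. -/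
theorem exists_curve_of_forall_fixed (ρ : Γ →* Equiv.Perm M) {x : M}
    (hρ : ∀ γ, ContMDiffAt 𝓘(ℝ, E) 𝓘(ℝ, E) 1 (ρ γ) x) (hfix : ∀ γ, ρ γ x = x)
    {L : Γ → E →L[ℝ] E} (hL : ∀ γ, HasMFDerivAt 𝓘(ℝ, E) 𝓘(ℝ, E) (ρ γ) x (L γ)) {v : E}
    (hv : ∀ γ, L γ v = v) :
    ∃ c : ℝ → M, c 0 = x ∧
      HasMFDerivAt 𝓘(ℝ, ℝ) 𝓘(ℝ, E) c 0 (ContinuousLinearMap.toSpanSingleton ℝ v : ℝ →L[ℝ] E) ∧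
      ∀ᶠ t in 𝓝 0, c t ∈ connectedComponentIn {y | ∀ γ, ρ γ y = y} x := by
  obtain ⟨Φ, hs, hx0, hd, hΦ⟩ := exists_linearization ρ hρ hfix hL
  have h0t : (0 : E) ∈ Φ.target := hx0 ▸ Φ.map_source hs
  have hΦ0 : Φ.symm 0 = x := by rw [← hx0, Φ.left_inv hs]
  let l : ℝ → E := fun t => t • v
  have hl : Continuous l := by fun_prop
  have hl0 : l 0 = 0 := zero_smul ℝ v
  have hld : HasMFDerivAt 𝓘(ℝ, ℝ) 𝓘(ℝ, E) l 0
      (ContinuousLinearMap.toSpanSingleton ℝ v : ℝ →L[ℝ] E) :=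
    (ContinuousLinearMap.toSpanSingleton ℝ v).hasFDerivAt.hasMFDerivAt
  let c : ℝ → M := fun t => Φ.symm (l t)
  have hc0 : c 0 = x := by simp only [c, hl0, hΦ0]
  have htgt : ∀ᶠ t in 𝓝 (0 : ℝ), l t ∈ Φ.target :=
    hl.continuousAt.eventually_mem (by rw [hl0]; exact Φ.open_target.mem_nhds h0t)
  have hcc : ContinuousAt c 0 :=
    ContinuousAt.comp (by rw [hl0]; exact Φ.continuousAt_symm h0t) hl.continuousAt
  refine ⟨c, hc0, ?_, ?_⟩
  · rw [← hl0] at hd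
    exact hd.comp (0 : ℝ) hld
  · have hsrc : ∀ γ, ∀ᶠ t in 𝓝 (0 : ℝ), ρ γ (c t) ∈ Φ.source := fun γ => by
      have h1 : ContinuousAt (fun t => ρ γ (c t)) 0 :=
        ContinuousAt.comp (by rw [hc0]; exact (hρ γ).continuousAt) hcc
      exact h1.eventually_mem (by rw [hc0, hfix]; exact Φ.open_source.mem_nhds hs)
    have hev : ∀ γ, ∀ᶠ t in 𝓝 (0 : ℝ), Φ (ρ γ (c t)) =
        L γ (Φ (c t)) := fun γ => by
      have h1 := hΦ γ
      rw [← hc0] at h1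
      exact hcc.eventually h1
    have hmem : ∀ᶠ t in 𝓝 (0 : ℝ), l t ∈ Φ.target ∧ ∀ γ, ρ γ (c t) = c t := by
      filter_upwards [htgt, Filter.eventually_all.2 hsrc, Filter.eventually_all.2 hev]
        with t ht hts hte
      refine ⟨ht, fun γ => Φ.injOn (hts γ) (Φ.map_target ht) ?_⟩
      rw [hte γ, Φ.right_inv ht, map_smul, hv γ]
    obtain ⟨ε, hε, hball⟩ := Metric.eventually_nhds_iff_ball.1 hmem
    have hcon : ContinuousOn c (Metric.ball 0 ε) :=
      Φ.continuousOn_symm.comp hl.continuousOn fun t ht => (hball t ht).1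
    have hpre : IsPreconnected (c '' Metric.ball 0 ε) :=
      (convex_ball (0 : ℝ) ε).isPreconnected.image c hcon
    have hsub := hpre.subset_connectedComponentIn (x := x) (F := {y | ∀ γ, ρ γ y = y})
      ⟨0, Metric.mem_ball_self hε, hc0⟩ (by rintro _ ⟨t, ht, rfl⟩; exact (hball t ht).2)
    filter_upwards [Metric.ball_mem_nhds 0 hε] with t ht
    exact hsub ⟨t, ht, rfl⟩

end FiniteActions

/-! ### Derivatives in the model spaces -/

/-- The chain rule with the derivatives given as maps between the model spaces, so that the
middle point need only be propositionally equal to `f x`. -/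
theorem HasMFDerivAt.comp_of_eq {E F V M N P : Type*} [NormedAddCommGroup E] [NormedSpace ℝ E]
    [NormedAddCommGroup F] [NormedSpace ℝ F] [NormedAddCommGroup V] [NormedSpace ℝ V]
    [TopologicalSpace M] [ChartedSpace E M] [TopologicalSpace N] [ChartedSpace F N]
    [TopologicalSpace P] [ChartedSpace V P] {f : M → N} {g : N → P} {x : M} {y : N}
    {A : E →L[ℝ] F} {B : F →L[ℝ] V} (hg : HasMFDerivAt 𝓘(ℝ, F) 𝓘(ℝ, V) g y B)
    (hf : HasMFDerivAt 𝓘(ℝ, E) 𝓘(ℝ, F) f x A) (h : f x = y) :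
    HasMFDerivAt 𝓘(ℝ, E) 𝓘(ℝ, V) (g ∘ f) x (B ∘L A) := by
  subst h
  exact hg.comp x hf

/-- The derivative of the multiplication of a Lie group at `(1, 1)` is the addition, so the
derivative of a product of maps fixing `1` is the sum of the derivatives. -/
theorem HasMFDerivAt.mul_at_one {E G : Type*} [NormedAddCommGroup E] [NormedSpace ℝ E]
    [TopologicalSpace G] [ChartedSpace E G] [Group G] [LieGroup 𝓘(ℝ, E) ∞ G]
    {f g : G → G} {A B : E →L[ℝ] E} (hf : HasMFDerivAt 𝓘(ℝ, E) 𝓘(ℝ, E) f 1 A)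
    (hg : HasMFDerivAt 𝓘(ℝ, E) 𝓘(ℝ, E) g 1 B) (hf1 : f 1 = 1) (hg1 : g 1 = 1) :
    HasMFDerivAt 𝓘(ℝ, E) 𝓘(ℝ, E) (fun a => f a * g a) 1 (A + B) := by
  have hm : MDifferentiableAt (𝓘(ℝ, E).prod 𝓘(ℝ, E)) 𝓘(ℝ, E) (fun p : G × G => p.1 * p.2)
      (1, 1) := (contMDiff_mul 𝓘(ℝ, E) ∞).mdifferentiableAt (by simp)
  have hadd : ∀ v w : E, (mfderiv (𝓘(ℝ, E).prod 𝓘(ℝ, E)) 𝓘(ℝ, E) (fun p : G × G => p.1 * p.2)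
      (1, 1) : E × E →L[ℝ] E) (v, w) = v + w := fun v w => by
    have e1 : HasMFDerivAt 𝓘(ℝ, E) 𝓘(ℝ, E) (fun z : G => z * 1) 1 (.id ℝ E) :=
      (hasMFDerivAt_id (1 : G)).congr_of_eventuallyEq (.of_forall mul_one)
    have e2 : HasMFDerivAt 𝓘(ℝ, E) 𝓘(ℝ, E) (fun z : G => 1 * z) 1 (.id ℝ E) :=
      (hasMFDerivAt_id (1 : G)).congr_of_eventuallyEq (.of_forall one_mul)
    refine (mfderiv_prod_eq_add_apply hm).trans ?_
    exact congrArg₂ (fun S T : E →L[ℝ] E => S v + T w) e1.mfderiv e2.mfderiv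
  have hm' := hm.hasMFDerivAt
  rw [show ((1, 1) : G × G) = (f 1, g 1) by rw [hf1, hg1]] at hm'
  refine (HasMFDerivAt.comp (1 : G) hm' (hf.prodMk hg)).congr_mfderiv ?_
  rw [hf1, hg1]
  ext v
  exact hadd (A v) (B v)

/-! ### Symmetries of a `Γ`-symmetric space -/

namespace GammaSymmetricSpace

variable {Γ E F G : Type*} [CommGroup Γ] [Finite Γ]
  [NormedAddCommGroup E] [NormedSpace ℝ E] [NormedAddCommGroup F] [NormedSpace ℝ F]
  [TopologicalSpace G] [ChartedSpace E G] [Group G] [LieGroup 𝓘(ℝ, E) ∞ G] {H : Subgroup G}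
  (D : GammaSymmetricSpace Γ E H)

theorem symmetryFun_self (γ : Γ) (x : G ⧸ H) : D.symmetryFun γ x x = x := by
  induction x using QuotientGroup.induction_on with
  | H a => simp [symmetryFun_mk]

variable [ChartedSpace F (G ⧸ H)] [IsManifold 𝓘(ℝ, F) ∞ (G ⧸ H)]
  (hπ : Manifold.IsSubmersion 𝓘(ℝ, E) 𝓘(ℝ, F) ∞ (fun g : G => (g : G ⧸ H)))

include hπ in
/-- The symmetry `s_(γ, x)(y)` depends smoothly on the pair `(x, y)`. -/
theorem contMDiff_uncurry_symmetryFun (γ : Γ) :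
    ContMDiff (𝓘(ℝ, F).prod 𝓘(ℝ, F)) 𝓘(ℝ, F) ∞
      (Function.uncurry (D.symmetryFun γ)) := by
  rintro ⟨x, y⟩
  induction x using QuotientGroup.induction_on with
  | H a =>
  induction y using QuotientGroup.induction_on with
  | H b =>
  obtain ⟨σ, hσ, -, hσe⟩ := (hπ.isSubmersionAt a).exists_localSection
  obtain ⟨τ, hτ, -, hτe⟩ := (hπ.isSubmersionAt b).exists_localSection
  let p : (G ⧸ H) × (G ⧸ H) := ((a : G ⧸ H), (b : G ⧸ H))
  have hσ' : ContMDiffAt (𝓘(ℝ, F).prod 𝓘(ℝ, F)) 𝓘(ℝ, E) ∞ (fun q => σ q.1) p :=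
    ContMDiffAt.comp p hσ contMDiffAt_fst
  have hτ' : ContMDiffAt (𝓘(ℝ, F).prod 𝓘(ℝ, F)) 𝓘(ℝ, E) ∞ (fun q => τ q.2) p :=
    ContMDiffAt.comp p hτ contMDiffAt_snd
  have hlift : ContMDiffAt (𝓘(ℝ, F).prod 𝓘(ℝ, F)) 𝓘(ℝ, F) ∞
      (fun q => ((σ q.1 * D.rho γ ((σ q.1)⁻¹ * τ q.2) : G) : G ⧸ H)) p :=
    (hπ.contMDiff _).comp p (hσ'.mul ((D.contMDiff_rho γ _).comp p (hσ'.inv.mul hτ')))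
  refine hlift.congr_of_eventuallyEq ?_
  filter_upwards [(continuousAt_fst (p := p)).eventually hσe,
    (continuousAt_snd (p := p)).eventually hτe] with q h1 h2
  conv_lhs => rw [Function.uncurry, ← h1, ← h2]
  rfl

include hπ in
theorem contMDiff_symmetryFun (γ : Γ) (x : G ⧸ H) :
    ContMDiff 𝓘(ℝ, F) 𝓘(ℝ, F) ∞ (D.symmetryFun γ x) :=
  (D.contMDiff_uncurry_symmetryFun hπ γ).comp (contMDiff_const.prodMk contMDiff_id)

include hπ in
/-- For `x` the class of `a`, the orbit map `p : g ↦ a g H` has surjective derivative at `1` and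
intertwines `ρ_γ` with `s_(γ, x)`. It replaces the conjugation of `s_(γ, x)` to the base point. -/
theorem exists_orbitMap (x : G ⧸ H) :
    ∃ (p : G → G ⧸ H) (P : E →L[ℝ] F), p 1 = x ∧ HasMFDerivAt 𝓘(ℝ, E) 𝓘(ℝ, F) p 1 P ∧
      Function.Surjective P ∧ (∀ γ g, D.symmetryFun γ x (p g) = p (D.rho γ g)) ∧
      ∀ g g', p g = p g' ↔ g⁻¹ * g' ∈ H := by
  induction x using QuotientGroup.induction_on with
  | H a =>
  obtain ⟨σ, hσ, hσa, hσe⟩ := (hπ.isSubmersionAt a).exists_localSection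
  let p : G → G ⧸ H := fun g => ((a * g : G) : G ⧸ H)
  have hp : ContMDiff 𝓘(ℝ, E) 𝓘(ℝ, F) ∞ p :=
    hπ.contMDiff.comp (contMDiff_mul_left (I := 𝓘(ℝ, E)) (a := a))
  let σ' : G ⧸ H → G := fun y => a⁻¹ * σ y
  have hσ' : ContMDiffAt 𝓘(ℝ, F) 𝓘(ℝ, E) ∞ σ' (a : G ⧸ H) :=
    (contMDiff_mul_left (I := 𝓘(ℝ, E)) (a := a⁻¹) _).comp _ hσ
  have hσ'a : σ' (a : G ⧸ H) = 1 := by simp [σ', hσa]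
  have hP := ((hp 1).mdifferentiableAt (by simp)).hasMFDerivAt
  have hS := (hσ'.mdifferentiableAt (by simp)).hasMFDerivAt
  refine ⟨p, mfderiv 𝓘(ℝ, E) 𝓘(ℝ, F) p 1, by simp [p], hP, fun v => ?_, fun γ g => ?_,
    fun g g' => ?_⟩
  · have h1 := HasMFDerivAt.comp_of_eq hP hS hσ'a
    have h2 : HasMFDerivAt 𝓘(ℝ, F) 𝓘(ℝ, F) (p ∘ σ') (a : G ⧸ H) (.id ℝ F) := by
      refine (hasMFDerivAt_id (a : G ⧸ H)).congr_of_eventuallyEq ?_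
      filter_upwards [hσe] with y hy
      simpa [p, σ'] using hy
    exact ⟨_, congrArg (fun T : F →L[ℝ] F => T v) (hasMFDerivAt_unique h1 h2)⟩
  · simp [p, symmetryFun_mk]
  · simp only [p, QuotientGroup.eq]
    simp [mul_assoc]

/-- The tangent map `S_x(γ)` of `s_(γ, x)` at its fixed point `x`, read in the model space
`F`, of which `T_x M` is a copy. -/
noncomputable def tangentSymmetry (γ : Γ) (x : G ⧸ H) : F →L[ℝ] F :=
  mfderiv 𝓘(ℝ, F) 𝓘(ℝ, F) (D.symmetryFun γ x) x

include hπ in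
theorem hasMFDerivAt_symmetryFun (γ : Γ) (x : G ⧸ H) :
    HasMFDerivAt 𝓘(ℝ, F) 𝓘(ℝ, F) (D.symmetryFun γ x) x (D.tangentSymmetry (F := F) γ x) :=
  ((D.contMDiff_symmetryFun hπ γ x x).mdifferentiableAt (by simp)).hasMFDerivAt

include hπ in
theorem tangentSymmetry_one (x : G ⧸ H) :
    D.tangentSymmetry (F := F) 1 x = 1 := by
  refine hasMFDerivAt_unique (D.hasMFDerivAt_symmetryFun hπ 1 x) ?_
  exact (hasMFDerivAt_id x).congr_of_eventuallyEq (.of_forall (D.symmetryFun_one x))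

include hπ in
theorem tangentSymmetry_mul (γ δ : Γ) (x : G ⧸ H) :
    D.tangentSymmetry (F := F) (γ * δ) x = D.tangentSymmetry γ x * D.tangentSymmetry δ x := by
  refine hasMFDerivAt_unique (D.hasMFDerivAt_symmetryFun hπ (γ * δ) x) ?_
  exact ((D.hasMFDerivAt_symmetryFun hπ γ x).comp_of_eq (D.hasMFDerivAt_symmetryFun hπ δ x)
    (D.symmetryFun_self δ x)).congr_of_eventuallyEq (.of_forall (D.symmetryFun_mul γ δ x))

/-- The derivatives `θ γ` of the automorphisms at `1`, read in the model space `E`, are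
multiplicative in `γ`. -/
theorem exists_hasMFDerivAt_rho : ∃ θ : Γ → E →L[ℝ] E,
    (∀ γ, HasMFDerivAt 𝓘(ℝ, E) 𝓘(ℝ, E) (D.rho γ) 1 (θ γ)) ∧
      ∀ γ δ, θ (γ * δ) = θ γ ∘L θ δ := by
  have h : ∀ γ, HasMFDerivAt 𝓘(ℝ, E) 𝓘(ℝ, E) (D.rho γ) 1
      (mfderiv 𝓘(ℝ, E) 𝓘(ℝ, E) (D.rho γ) 1) := fun γ =>
    ((D.contMDiff_rho γ 1).mdifferentiableAt (by simp)).hasMFDerivAt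
  refine ⟨fun γ => mfderiv 𝓘(ℝ, E) 𝓘(ℝ, E) (D.rho γ) 1, h, fun γ δ => ?_⟩
  refine hasMFDerivAt_unique (h (γ * δ)) ?_
  refine (HasMFDerivAt.comp_of_eq (h γ) (h δ) (map_one _)).congr_of_eventuallyEq (.of_forall ?_)
  intro g
  simp

/-- The action of `Γ` on `G`, by permutations of the underlying set. -/
def rhoPerm : Γ →* Equiv.Perm G :=
  (MulAut.toPerm G).comp D.rho

include hπ in
/-- No nonzero tangent vector at `x` is fixed by `Γ`: a fixed vector lifts, up to the factor `|Γ|`,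
to a `Γ`-fixed vector at `1 : G`, which is tangent to the identity component of `G^Γ`, hence to
`H`. -/
theorem eq_zero_of_forall_tangentSymmetry_eq [CompleteSpace E] (x : G ⧸ H) (v : F)
    (hv : ∀ γ, D.tangentSymmetry γ x v = v) : v = 0 := by
  classical
  have := Fintype.ofFinite Γ
  obtain ⟨p, P, hp1, hP, hsurj, hequi, hpH⟩ := D.exists_orbitMap hπ x
  obtain ⟨θ, hθ, hθmul⟩ := D.exists_hasMFDerivAt_rho
  obtain ⟨X, rfl⟩ := hsurj v
  have hPθ : ∀ γ, P (θ γ X) = P X := fun γ => by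
    have h1 := hP.comp_of_eq (hθ γ) (map_one _)
    have h2 := (D.hasMFDerivAt_symmetryFun hπ γ x).comp_of_eq hP hp1
    have h3 := hasMFDerivAt_unique h1
      (h2.congr_of_eventuallyEq (.of_forall fun g => (hequi γ g).symm))
    exact (congrArg (fun T : E →L[ℝ] F => T X) h3).trans (hv γ)
  let Y : E := ∑ γ, θ γ X
  have hY : ∀ γ, θ γ Y = Y := fun γ => by
    simp only [Y, map_sum]
    refine (Finset.sum_congr rfl fun δ _ => ?_).trans
      (Equiv.sum_comp (Equiv.mulLeft γ) fun δ => θ δ X)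
    simp [hθmul]
  have hPY : P Y = (Fintype.card Γ : ℝ) • P X := by
    simp [Y, hPθ, ← Nat.cast_smul_eq_nsmul ℝ]
  have : IsManifold 𝓘(ℝ, E) 1 G := IsManifold.of_le (n := ∞) (by simp)
  obtain ⟨c, hc0, hc, hcfix⟩ := exists_curve_of_forall_fixed D.rhoPerm (x := (1 : G))
    (fun γ => (D.contMDiff_rho γ 1).of_le (by simp)) (fun γ => map_one (D.rho γ)) hθ hY
  have hcH : ∀ᶠ t in 𝓝 0, (p ∘ c) t = p 1 := hcfix.mono fun t ht =>
    ((hpH 1 (c t)).2 (by simpa using D.component_subset ht)).symm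
  have h1 : P ∘L ContinuousLinearMap.toSpanSingleton ℝ Y = (0 : ℝ →L[ℝ] F) :=
    hasMFDerivAt_unique (hP.comp_of_eq hc hc0)
      ((hasMFDerivAt_const (p 1) (0 : ℝ)).congr_of_eventuallyEq hcH)
  have h2 : P Y = 0 := by
    have := congrArg (fun T : ℝ →L[ℝ] F => T 1) h1
    simpa using this
  rw [hPY] at h2
  exact (smul_eq_zero.1 h2).resolve_left (by simp)

include hπ in
theorem isIsolatedFixedPoint_symmetryGroup [CompleteSpace E] [CompleteSpace F] (x : G ⧸ H) :
    IsIsolatedFixedPoint (D.symmetryGroup x) x := by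
  have : IsManifold 𝓘(ℝ, F) 1 (G ⧸ H) := IsManifold.of_le (n := ∞) (by simp)
  have h := eventually_eq_of_forall_fixed (D.symmetry x) (x := x)
    (fun γ => (D.contMDiff_symmetryFun hπ γ x x).of_le (by simp))
    (fun γ => D.symmetryFun_self γ x) (fun γ => D.hasMFDerivAt_symmetryFun hπ γ x)
    (D.eq_zero_of_forall_tangentSymmetry_eq hπ x)
  refine ⟨?_, _, h, fun y hy hfix => hy fun γ => hfix _ ⟨γ, rfl⟩⟩
  rintro _ ⟨γ, rfl⟩
  exact D.symmetryFun_self γ x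

/-- If `ρ_γ` induces the identity of `G ⧸ H`, then `γ = 1`: the derivative of `ρ_γ` at `1` is
unipotent and of finite order, so it is the identity. -/
theorem eq_one_of_inv_mul_rho_mem [CompleteSpace E] {γ : Γ}
    (hγ : ∀ g, g⁻¹ * D.rho γ g ∈ H) : γ = 1 := by
  obtain ⟨θ, hθ, hθmul⟩ := D.exists_hasMFDerivAt_rho
  let h : G → G := fun g => g⁻¹ * D.rho γ g
  have hh1 : h 1 = 1 := by simp [h]
  have hsm : ContMDiff 𝓘(ℝ, E) 𝓘(ℝ, E) ∞ h :=
    (contMDiff_inv 𝓘(ℝ, E) ∞).mul (D.contMDiff_rho γ)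
  obtain ⟨A, hA⟩ : ∃ A : E →L[ℝ] E, HasMFDerivAt 𝓘(ℝ, E) 𝓘(ℝ, E) h 1 A :=
    ⟨_, ((hsm 1).mdifferentiableAt (by simp)).hasMFDerivAt⟩
  have hθA : θ γ = .id ℝ E + A := by
    refine hasMFDerivAt_unique (hθ γ) ?_
    refine (HasMFDerivAt.mul_at_one (hasMFDerivAt_id (1 : G)) hA rfl hh1).congr_of_eventuallyEq
      (.of_forall fun g => ?_)
    simp [h]
  have hθA' : θ γ ∘L A = A :=
    hasMFDerivAt_unique ((hθ γ).comp_of_eq hA hh1)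
      (hA.congr_of_eventuallyEq (.of_forall fun g => D.le_fixed (hγ g) γ))
  -- Stated for `k + 1`, so that the induction starts at `θ γ = 1 + A`; it is used with `k` the
  -- order of `γ`.
  have hpow : ∀ k : ℕ, ∀ v, θ (γ ^ (k + 1)) v = v + ((k + 1 : ℕ) : ℝ) • A v := by
    intro k v
    induction k with
    | zero => simp [hθA]
    | succ k ih =>
      have hAv : θ γ (A v) = A v := congrArg (fun T : E →L[ℝ] E => T v) hθA'
      rw [pow_succ', hθmul, ContinuousLinearMap.comp_apply, ih, map_add, map_smul, hAv]
      simp only [hθA, add_apply, ContinuousLinearMap.id_apply]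
      push_cast
      module
  have hA0 : ∀ v, A v = 0 := fun v => by
    have h1 : θ (γ ^ (orderOf γ + 1)) v = θ γ v := by rw [pow_succ, pow_orderOf_eq_one, one_mul]
    rw [hpow, hθA] at h1
    have h2 : ((orderOf γ : ℕ) : ℝ) • A v = 0 := by
      simp only [add_apply, ContinuousLinearMap.id_apply, add_right_inj] at h1
      push_cast at h1
      rwa [add_smul, one_smul, add_eq_right] at h1
    exact (smul_eq_zero.1 h2).resolve_left (by simp [(isOfFinOrder_of_finite γ).orderOf_pos.ne'])
  have : IsManifold 𝓘(ℝ, E) 1 G := IsManifold.of_le (n := ∞) (by simp)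
  have hev := eventually_eq_self_of_hasMFDerivAt_id D.rhoPerm (x := (1 : G)) (γ := γ)
    (fun γ => (D.contMDiff_rho γ 1).of_le (by simp)) (fun γ => map_one (D.rho γ)) hθ
    (fun v => by simp [hθA, hA0])
  have : IsTopologicalGroup G := topologicalGroup_of_lieGroup 𝓘(ℝ, E) ∞
  have := D.connected
  let K : Subgroup G := (D.rho γ).toMonoidHom.eqLocus (MonoidHom.id G)
  have hK : IsOpen (K : Set G) := K.isOpen_of_mem_nhds hev
  have hKu : (K : Set G) = Set.univ :=
    IsClopen.eq_univ ⟨K.isClosed_of_isOpen hK, hK⟩ ⟨1, K.one_mem⟩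
  refine D.rho_injective ?_
  ext g
  rw [map_one]
  have hg : g ∈ (K : Set G) := hKu ▸ Set.mem_univ g
  exact hg

include hπ in
theorem symmetry_injective [CompleteSpace E] (x : G ⧸ H) : Function.Injective (D.symmetry x) := by
  obtain ⟨p, P, -, -, -, hequi, hpH⟩ := D.exists_orbitMap hπ x
  refine (injective_iff_map_eq_one _).2 fun γ hγ => D.eq_one_of_inv_mul_rho_mem fun g => ?_
  rw [← hpH, ← hequi]
  exact (congrArg (fun s : Equiv.Perm (G ⧸ H) => s (p g)) hγ).symm

include hπ in
theorem symmetryGroup_le_diffeoGroup (x : G ⧸ H) : D.symmetryGroup x ≤ diffeoGroup F (G ⧸ H) := by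
  rintro _ ⟨γ, rfl⟩
  exact ⟨D.contMDiff_symmetryFun hπ γ x, D.contMDiff_symmetryFun hπ γ⁻¹ x⟩

include hπ in
/-- The field `x ↦ S_x(γ)` is smooth: it is the partial derivative in `y` of the smooth map
`(x, y) ↦ s_(γ, x)(y)` along the diagonal. -/
theorem contMDiff_tangentSymmetry (γ : Γ) :
    ContMDiff 𝓘(ℝ, F) (𝓘(ℝ, F).prod 𝓘(ℝ, F →L[ℝ] F)) ∞
      (fun x : G ⧸ H => Bundle.TotalSpace.mk' (F →L[ℝ] F)
        (E := fun y : G ⧸ H => TangentSpace 𝓘(ℝ, F) y →L[ℝ] TangentSpace 𝓘(ℝ, F) y) x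
        (D.tangentSymmetry (F := F) γ x)) := by
  intro x
  rw [contMDiffAt_hom_bundle]
  refine ⟨contMDiffAt_id, ?_⟩
  have h := ContMDiffAt.mfderiv (m := ∞) (x₀ := x) (D.symmetryFun γ) id
    (D.contMDiff_uncurry_symmetryFun hπ γ (x, x)) contMDiffAt_id (by simp)
  simp only [id, symmetryFun_self] at h
  exact h

/-- The representation `S_x` of `Γ` on `T_x M`. It is built on the model space `F`, of which
`T_x M` is a copy. -/
noncomputable def tangentRep (x : G ⧸ H) :
    Γ →* (TangentSpace 𝓘(ℝ, F) x ≃L[ℝ] TangentSpace 𝓘(ℝ, F) x) :=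
  let φ : Γ →* (F →L[ℝ] F) :=
    { toFun := fun γ => D.tangentSymmetry γ x
      map_one' := D.tangentSymmetry_one hπ x
      map_mul' := fun γ δ => D.tangentSymmetry_mul hπ γ δ x }
  (ContinuousLinearEquiv.unitsEquiv ℝ F).toMonoidHom.comp φ.toHomUnits

end GammaSymmetricSpace

/-- The smooth structure of the homogeneous space `G ⧸ H` (with the quotient topology) is the
unique one for which the projection `G → G ⧸ H` is a smooth submersion. -/
theorem mainTheorem6 {Γ E F G : Type*} [CommGroup Γ] [Finite Γ]
    [NormedAddCommGroup E] [NormedSpace ℝ E] [FiniteDimensional ℝ E]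
    [NormedAddCommGroup F] [NormedSpace ℝ F] [FiniteDimensional ℝ F]
    [TopologicalSpace G] [ChartedSpace E G] [Group G] [LieGroup 𝓘(ℝ, E) ∞ G]
    (H : Subgroup G)
    [ChartedSpace F (G ⧸ H)] [IsManifold 𝓘(ℝ, F) ∞ (G ⧸ H)]
    (hπ : Manifold.IsSubmersion 𝓘(ℝ, E) 𝓘(ℝ, F) ∞ (fun g : G => (g : G ⧸ H)))
    (D : GammaSymmetricSpace Γ E H) :
    (∀ x : G ⧸ H, D.symmetryGroup x ≤ diffeoGroup F (G ⧸ H) ∧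
      (∃ e : Γ ≃* D.symmetryGroup x, ∀ γ, (e γ : Equiv.Perm (G ⧸ H)) = D.symmetry x γ) ∧
      IsIsolatedFixedPoint (D.symmetryGroup x) x) ∧
    ∃ S : GammaSymmetricStructure Γ F (G ⧸ H),
      ∀ (x : G ⧸ H) (γ : Γ) (v : TangentSpace 𝓘(ℝ, F) x),
        (⟨x, S.rep x γ v⟩ : TangentBundle 𝓘(ℝ, F) (G ⧸ H)) =
          tangentMap 𝓘(ℝ, F) 𝓘(ℝ, F) (D.symmetry x γ) ⟨x, v⟩ := by
  have := FiniteDimensional.complete ℝ E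
  have := FiniteDimensional.complete ℝ F
  refine ⟨fun x => ⟨D.symmetryGroup_le_diffeoGroup hπ x,
    ⟨MonoidHom.ofInjective (D.symmetry_injective hπ x), fun γ => rfl⟩,
    D.isIsolatedFixedPoint_symmetryGroup hπ x⟩,
    { rep := D.tangentRep hπ
      contMDiff_rep := D.contMDiff_tangentSymmetry hπ
      eq_zero_of_fixed := D.eq_zero_of_forall_tangentSymmetry_eq hπ }, fun x γ v => ?_⟩
  -- The base points `s_(γ, x)(x)` and `x` of the two tangent vectors are only propositionally
  -- equal.
  have hmk : ∀ y : G ⧸ H, y = x → ∀ w : F,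
      (⟨x, w⟩ : TangentBundle 𝓘(ℝ, F) (G ⧸ H)) = ⟨y, w⟩ := by
    rintro _ rfl w
    rfl
  exact hmk _ (D.symmetryFun_self γ x) (D.tangentSymmetry γ x v)
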